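/- A sign pattern of order $n$ is an $n\times n$ matrix $\mathcal P=[p_{ij}]$ with entries in $\{+,-,0\}$. Its qualitative class $Q(\mathcal P)$ is the set of all real $n\times n$ matrices $B=[b_{ij}]$ such that $b_{ij}$ has sign $p_{ij}$ for all $i,j$. The pattern $\mathcal P$ is *sign semi-stable* if, for every $B\in Q(\mathcal P)$, every complex eigenvalue of $B$ has nonpositive real part. The sepr-sequence of a real $n\times n$ matrix $B$ is $t_1(B)t_2(B)\cdots t_n(B)$, where $t_k(B)$ records the signs of the principal minors of $B$ of order $k$: $t_k(B)=\mathtt A^{*}$ if all of them are nonzero and both signs occur; $\mathtt A^{+}$ (resp. $\mathtt A^{-}$) if all are positive (resp. negative); $\mathtt N$ if all are zero; $\mathtt S^{*}$ if a positive, a negative and a zero one all occur; $\mathtt S^{+}$ (resp. $\mathtt S^{-}$) if both a zero and a nonzero one occur and every nonzero one is positive (resp. negative). A sign pattern $\mathcal P$ has a *unique sepr-sequence* if all matrices in $Q(\mathcal P)$ have the same sepr-sequence; this common sequence is then denoted $\operatorname{sepr}(\mathcal P)=t_1(\mathcal P)\cdots t_n(\mathcal P)$. **Theorem.** Let $\mathcal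 P$ be a sign semi-stable pattern of order $n$. Then $\mathcal P$ has a unique sepr-sequence, and the following are equivalent: 1. every sign pattern that has a unique sepr-sequence and whose sepr-sequence equals $\operatorname{sepr}(\mathcal P)$ is sign semi-stable; 2. $t_k(\mathcal P)=\mathtt N$ for all $k$ with $3\le k\le n$, or $n\le 2$. -/

import Mathlib

/-- The seven symbols that can occur in a signed enhanced principal rank characteristic sequence
(sepr-sequence). -/
inductive SeprSymbol : Type
  | Astar
  | Aplus
  | Aminus
  | N
  | Sstar
  | Splus
  | Sminus

/-- The principal minor of `B` on the rows and columns indexed by `α`. -/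
def principalMinor {n : ℕ} (B : Matrix (Fin n) (Fin n) ℝ) (α : Finset (Fin n)) : ℝ :=
  (B.submatrix (fun i : α => (i : Fin n)) (fun i : α => (i : Fin n))).det

/-- `B` has a positive principal minor of order `k`. -/
def HasPosMinor {n : ℕ} (B : Matrix (Fin n) (Fin n) ℝ) (k : ℕ) : Prop :=
  ∃ α : Finset (Fin n), α.card = k ∧ 0 < principalMinor B α

/-- `B` has a negative principal minor of order `k`. -/
def HasNegMinor {n : ℕ} (B : Matrix (Fin n) (Fin n) ℝ) (k : ℕ) : Prop :=
  ∃ α : Finset (Fin n), α.card = k ∧ principalMinor B α < 0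

/-- `B` has a principal minor of order `k` that is equal to zero. -/
def HasZeroMinor {n : ℕ} (B : Matrix (Fin n) (Fin n) ℝ) (k : ℕ) : Prop :=
  ∃ α : Finset (Fin n), α.card = k ∧ principalMinor B α = 0

open Classical in
/-- The symbol `t_k(B)`. It is meaningful for `1 ≤ k ≤ n`, so that there is a principal minor of
order `k`; in the last branch every principal minor of order `k` is negative. -/
noncomputable def seprTerm {n : ℕ} (B : Matrix (Fin n) (Fin n) ℝ) (k : ℕ) : SeprSymbol :=
  if HasZeroMinor B k then
    if HasPosMinor B k then
      if HasNegMinor B k then SeprSymbol.Sstar else SeprSymbol.Splus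
    else
      if HasNegMinor B k then SeprSymbol.Sminus else SeprSymbol.N
  else
    if HasPosMinor B k then
      if HasNegMinor B k then SeprSymbol.Astar else SeprSymbol.Aplus
    else SeprSymbol.Aminus

/-- The sepr-sequence `t_1 t_2 ⋯ t_n` of a real `n × n` matrix, as a list of length `n`. -/
noncomputable def matrixSepr {n : ℕ} (B : Matrix (Fin n) (Fin n) ℝ) : List SeprSymbol :=
  List.ofFn (fun i : Fin n => seprTerm B (i.val + 1))

/-- A real square matrix is semi-stable if each of its (complex) eigenvalues has nonpositive
real part. -/
def IsSemiStable {n : ℕ} (B : Matrix (Fin n) (Fin n) ℝ) : Prop :=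
  ∀ z : ℂ, Module.End.HasEigenvalue (Matrix.toLin' (B.map (fun x : ℝ => (x : ℂ)))) z → z.re ≤ 0

/-- A (square) sign pattern of order `n`. -/
abbrev SignPattern (n : ℕ) : Type := Matrix (Fin n) (Fin n) SignType

namespace SignPattern

/-- The qualitative class `Q(P)`: all real matrices whose entries have the signs given by `P`. -/
def qualClass {n : ℕ} (P : SignPattern n) : Set (Matrix (Fin n) (Fin n) ℝ) :=
  {B | ∀ i j, SignType.sign (B i j) = P i j}

/-- A sign pattern is sign semi-stable if every matrix in its qualitative class is semi-stable. -/
def IsSignSemiStable {n : ℕ} (P : SignPattern n) : Prop :=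
  ∀ B ∈ P.qualClass, IsSemiStable B

/-- The sepr-set of `P`: the set of sepr-sequences of the matrices in `Q(P)`. -/
def seprSet {n : ℕ} (P : SignPattern n) : Set (List SeprSymbol) :=
  matrixSepr '' P.qualClass

/-- `P` has a unique sepr-sequence: its sepr-set has exactly one element. -/
def HasUniqueSepr {n : ℕ} (P : SignPattern n) : Prop :=
  ∃! s : List SeprSymbol, s ∈ P.seprSet

/-- The unique element of the sepr-set of a sign pattern with a unique sepr-sequence. -/
noncomputable def sepr {n : ℕ} (P : SignPattern n) (h : P.HasUniqueSepr) : List SeprSymbol :=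
  h.choose

end SignPattern

/-! Read `P i j ≠ 0` as an arc from `j` to `i`. Among the eigenvalues of a generalized permutation
matrix are the `k`-th roots of the product along a cycle of length `k`, and semi-stability passes to
limits of matrices in `Q(P)`. So in a sign semi-stable pattern no cycle has product `+`
(`negativeCycles`) and none is longer than two (`shortCycles`).

Negative cycles alone give every nonzero term of a principal minor of order `k` the sign `(-1)^k`.
Nothing cancels, so the sign of a minor depends only on whether its index set is supported
(`Supports`). This yields uniqueness of the sequence and lets patterns be compared through their
supported sets.

If all minors of order at least three vanish, the sequence forces the characteristic polynomial to
be, up to powers of the variable, a polynomial of degree at most two with nonnegative coefficients;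
its roots lie in the closed left half plane.

Otherwise some set of at least three indices is supported, and a pattern `R` is built with negative
cycles and the same supported sets, hence the same sequence, but with a cycle of length three or
four, hence not sign semi-stable. The 2-cycles of `P` form a forest. In it, or after joining
components by an extra edge, there is a path on three or four vertices whose vertex set is
supported. Keep only the loops and 2-cycles of `P`, and close the path to a directed cycle of
product `-`. Acyclicity makes this the only new cycle, and its vertex set was supported already. -/

open Equiv

/-! ### Semi-stability and the cycles of a pattern -/

/-- Semi-stability expressed through the roots of the characteristic polynomial. -/
theorem isSemiStable_iff_charpoly {n : ℕ} (B : Matrix (Fin n) (Fin n) ℝ) :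
    IsSemiStable B ↔
      ∀ z : ℂ, (B.map (fun x : ℝ => (x : ℂ))).charpoly.eval z = 0 → z.re ≤ 0 := by
  simp only [IsSemiStable, Module.End.hasEigenvalue_iff_isRoot_charpoly, Matrix.charpoly_toLin',
    Polynomial.IsRoot.def]

/-- The characteristic polynomial of a semi-stable matrix is bounded below on the right half
plane. -/
theorem IsSemiStable.re_pow_le_norm_eval_charpoly {n : ℕ} {B : Matrix (Fin n) (Fin n) ℝ}
    (hB : IsSemiStable B) {z : ℂ} (hz : 0 ≤ z.re) :
    z.re ^ n ≤ ‖(B.map (fun x : ℝ => (x : ℂ))).charpoly.eval z‖ := by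
  rw [isSemiStable_iff_charpoly] at hB
  set p := (B.map (fun x : ℝ => (x : ℂ))).charpoly with hp
  have hm : p.Monic := Matrix.charpoly_monic _
  have hs : p.Splits := IsAlgClosed.splits p
  have hcard : p.roots.card = n := by
    rw [← hs.natDegree_eq_card_roots, hp, Matrix.charpoly_natDegree_eq_dim, Fintype.card_fin]
  rw [hs.eval_eq_prod_roots_of_monic hm]
  have hroot : ∀ r ∈ p.roots, r.re ≤ 0 := fun r hr => hB r (Polynomial.isRoot_of_mem_roots hr)
  have key : ∀ m : Multiset ℂ, (∀ r ∈ m, r.re ≤ 0) →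
      z.re ^ m.card ≤ ‖(m.map fun r => z - r).prod‖ := by
    intro m
    induction m using Multiset.induction_on with
    | empty => simp
    | cons a m ih =>
      intro hm'
      rw [Multiset.card_cons, Multiset.map_cons, Multiset.prod_cons, norm_mul, pow_succ']
      have h1 : z.re ≤ ‖z - a‖ := by
        have h2 := Complex.re_le_norm (z - a)
        have h3 := hm' a (Multiset.mem_cons_self a m)
        rw [Complex.sub_re] at h2
        linarith
      exact mul_le_mul h1 (ih fun r hr => hm' r (Multiset.mem_cons_of_mem hr))
        (pow_nonneg hz _) (norm_nonneg _)
  simpa [hcard] using key p.roots hroot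

/-- Semi-stability is inherited by the matrices in the closure of the qualitative class. -/
theorem SignPattern.IsSignSemiStable.isSemiStable_of_eq_zero_or {n : ℕ} {P : SignPattern n}
    (hP : P.IsSignSemiStable) {B : Matrix (Fin n) (Fin n) ℝ}
    (hB : ∀ i j, B i j = 0 ∨ SignType.sign (B i j) = P i j) : IsSemiStable B := by
  rw [isSemiStable_iff_charpoly]
  intro z hz
  by_contra! hre
  -- Adding `ε * P i j` gives vanishing entries the sign of `P` and keeps the other signs. The lower
  -- bound `z.re ^ n` does not depend on `ε`, so it survives `ε → 0`.
  let F : ℝ → Matrix (Fin n) (Fin n) ℝ := fun ε => Matrix.of fun i j => B i j + ε * (P i j : ℝ)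
  have hF : ∀ ε > 0, F ε ∈ P.qualClass := by
    intro ε hε i j
    have hs : SignType.sign (ε * (P i j : ℝ)) = P i j := by
      rw [sign_mul, sign_pos hε, one_mul]
      cases P i j <;> simp
    rcases hB i j with h | h
    · simpa [F, h] using hs
    · simp only [F, Matrix.of_apply]
      rcases hv : P i j with _ | _ | _
      · rw [hv] at h
        simpa using h
      · rw [hv] at h
        have h' : B i j < 0 := sign_eq_neg_one_iff.1 h
        exact sign_neg (by simp; linarith)
      · rw [hv] at h
        have h' : 0 < B i j := sign_eq_one_iff.1 h
        exact sign_pos (by simp; linarith)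
  have hcont : Continuous fun ε : ℝ =>
      ‖((F ε).map (fun x : ℝ => (x : ℂ))).charpoly.eval z‖ := by
    simp only [Matrix.eval_charpoly]
    refine (Continuous.matrix_det ?_).norm
    refine continuous_const.sub (continuous_matrix fun i j => ?_)
    simp only [F, Matrix.map_apply, Matrix.of_apply]
    fun_prop
  have hlim := (hcont.tendsto 0).mono_left (nhdsWithin_le_nhds (s := Set.Ioi 0))
  have h0 : F 0 = B := by ext i j; simp [F]
  rw [h0, hz, norm_zero] at hlim
  have hle := ge_of_tendsto hlim (b := z.re ^ n) (by
    filter_upwards [self_mem_nhdsWithin] with ε hε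
    exact (hP _ (hF ε hε)).re_pow_le_norm_eval_charpoly hre.le)
  exact absurd hle (not_le.2 (pow_pos hre n))

theorem Equiv.Perm.IsCycleOn.prod_range_card {α M : Type*} [CommMonoid M] {σ : Perm α}
    {s : Finset α} (hσ : σ.IsCycleOn s) {a : α} (ha : a ∈ s) (f : α → M) :
    ∏ m ∈ Finset.range s.card, f ((σ ^ m) a) = ∏ j ∈ s, f j := by
  refine Finset.prod_bij (fun m _ => (σ ^ m) a) ?_ ?_ ?_ ?_
  · intro m _
    exact (hσ.1.perm_pow m).mapsTo ha
  · intro m hm m' hm' h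
    rw [hσ.pow_apply_eq_pow_apply ha] at h
    exact Nat.ModEq.eq_of_lt_of_lt h (Finset.mem_range.1 hm) (Finset.mem_range.1 hm')
  · intro b hb
    obtain ⟨m, hm, h⟩ := hσ.exists_pow_eq ha hb
    exact ⟨m, Finset.mem_range.2 hm, h⟩
  · intros; rfl

/-- The eigenvalues which a generalized permutation matrix has on one of its cycles. -/
theorem eval_charpoly_monomial_eq_zero {n : ℕ} {σ : Perm (Fin n)} {s : Finset (Fin n)}
    (hs : s.Nonempty) (hσ : σ.IsCycleOn s) (w : Fin n → ℂ) {z : ℂ} (hz : z ≠ 0)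
    (h : z ^ s.card = ∏ j ∈ s, w j) :
    (Matrix.of fun i j => if i = σ j then w j else 0).charpoly.eval z = 0 := by
  set A : Matrix (Fin n) (Fin n) ℂ := Matrix.of fun i j => if i = σ j then w j else 0 with hA
  obtain ⟨a, ha⟩ := hs
  have hcol : ∀ j, A.mulVec (Pi.single j 1) = w j • Pi.single (σ j) 1 := by
    intro j
    ext i
    simp [hA, Pi.single_apply]
  have hpow : ∀ m, (A ^ m).mulVec (Pi.single a 1) =
      (∏ l ∈ Finset.range m, w ((σ ^ l) a)) • Pi.single ((σ ^ m) a) 1 := by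
    intro m
    induction m with
    | zero => rw [pow_zero, Matrix.one_mulVec]; simp
    | succ m ih =>
      rw [pow_succ', ← Matrix.mulVec_mulVec, ih, Matrix.mulVec_smul, hcol, smul_smul,
        Finset.prod_range_succ, pow_succ' σ, Perm.mul_apply]
  have hcard : (A ^ s.card).mulVec (Pi.single a 1) = (z ^ s.card) • Pi.single a 1 := by
    rw [hpow, hσ.prod_range_card ha w, hσ.pow_card_apply ha, h]
  rw [Matrix.eval_charpoly, ← Matrix.exists_mulVec_eq_zero_iff]
  have hc : Commute (Matrix.scalar (Fin n) z) A := Matrix.scalar_commute z (fun r => mul_comm _ _) A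
  -- With `k = s.card`, the geometric sum times `z - A` is `z ^ k - A ^ k`, which kills the basis
  -- vector at `a`. The sum itself does not: only its term `z ^ (k - 1)` contributes to coordinate
  -- `a`.
  refine ⟨(∑ i ∈ Finset.range s.card,
    Matrix.scalar (Fin n) z ^ i * A ^ (s.card - 1 - i)).mulVec (Pi.single a 1), ?_, ?_⟩
  · intro h0
    have h1 := congrFun h0 a
    rw [Matrix.sum_mulVec, Finset.sum_apply, Pi.zero_apply] at h1
    have hpos : 0 < s.card := Finset.card_pos.2 ⟨a, ha⟩
    rw [Finset.sum_eq_single (s.card - 1)] at h1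
    · rw [Nat.sub_self, pow_zero, mul_one, ← map_pow] at h1
      simp [hz] at h1
    · intro m hm hne
      have hm' := Finset.mem_range.1 hm
      rw [← map_pow, ← Matrix.mulVec_mulVec, hpow]
      have hna : a ≠ (σ ^ (s.card - 1 - m)) a := by
        intro h2
        have h3 := Nat.le_of_dvd (by omega) ((hσ.pow_apply_eq ha).1 h2.symm)
        omega
      simp [Matrix.mulVec_smul, hna]
    · intro hm
      exact absurd (Finset.mem_range.2 (by omega)) hm
  · rw [Matrix.mulVec_mulVec, hc.mul_geom_sum₂, Matrix.sub_mulVec, hcard, ← map_pow]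
    ext i
    simp [Pi.single_apply]

namespace SignPattern

/-- No cycle of the sign pattern has product `+`. -/
def NegativeCycles {n : ℕ} (P : SignPattern n) : Prop :=
  ∀ (σ : Perm (Fin n)) (s : Finset (Fin n)), s.Nonempty → σ.IsCycleOn s →
    ∏ j ∈ s, P (σ j) j ≠ 1

/-- Every cycle of the sign pattern has length at most two. -/
def ShortCycles {n : ℕ} (P : SignPattern n) : Prop :=
  ∀ (σ : Perm (Fin n)) (s : Finset (Fin n)), s.Nonempty → σ.IsCycleOn s →
    (∀ j ∈ s, P (σ j) j ≠ 0) → s.card ≤ 2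

/-- Keeping only the arcs of `σ` gives a matrix in the closure of `Q(P)`, and `z` is one of its
eigenvalues. -/
theorem IsSignSemiStable.re_le_zero_of_pow_eq {n : ℕ} {P : SignPattern n}
    (hP : P.IsSignSemiStable) {σ : Perm (Fin n)} {s : Finset (Fin n)} (hs : s.Nonempty)
    (hσ : σ.IsCycleOn s) {z : ℂ} (hz : z ≠ 0)
    (h : z ^ s.card = ((∏ j ∈ s, P (σ j) j : SignType) : ℂ)) : z.re ≤ 0 := by
  let B : Matrix (Fin n) (Fin n) ℝ := Matrix.of fun i j => if i = σ j then (P i j : ℝ) else 0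
  have hB : IsSemiStable B := by
    refine hP.isSemiStable_of_eq_zero_or fun i j => ?_
    by_cases hij : i = σ j
    · right
      simp only [B, Matrix.of_apply, if_pos hij]
      cases P i j <;> simp
    · left
      simp [B, hij]
  refine (isSemiStable_iff_charpoly B).1 hB z ?_
  have hBA : B.map (fun x : ℝ => (x : ℂ)) =
      Matrix.of fun i j => if i = σ j then ((P (σ j) j : SignType) : ℂ) else 0 := by
    ext i j
    by_cases hij : i = σ j
    · subst hij
      simp only [B, Matrix.map_apply, Matrix.of_apply, if_true]
      cases P (σ j) j <;> simp
    · simp [B, hij]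
  rw [hBA]
  refine eval_charpoly_monomial_eq_zero hs hσ _ hz ?_
  rw [h]
  exact map_prod (SignType.castHom : SignType →*₀ ℂ) _ _

theorem IsSignSemiStable.negativeCycles {n : ℕ} {P : SignPattern n} (hP : P.IsSignSemiStable) :
    P.NegativeCycles := by
  intro σ s hs hσ h
  have := hP.re_le_zero_of_pow_eq hs hσ (z := 1) one_ne_zero (by rw [h]; simp)
  norm_num at this

theorem IsSignSemiStable.shortCycles {n : ℕ} {P : SignPattern n} (hP : P.IsSignSemiStable) :
    P.ShortCycles := by
  intro σ s hs hσ hne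
  by_contra! hcard
  have hprod : ∏ j ∈ s, P (σ j) j = -1 := by
    have h0 : ∏ j ∈ s, P (σ j) j ≠ 0 := by
      exact Finset.prod_ne_zero_iff.2 hne
    have h1 := hP.negativeCycles σ s hs hσ
    revert h0 h1
    generalize ∏ j ∈ s, P (σ j) j = c
    cases c <;> decide
  have hk : (0 : ℝ) < s.card := by positivity
  have hk3 : (3 : ℝ) ≤ s.card := by exact_mod_cast hcard
  -- The cycle product is `-1`, and `exp(iπ/k)` is a `k`-th root of `-1` whose real part `cos(π/k)`
  -- is positive once `k ≥ 3`.
  have hre := hP.re_le_zero_of_pow_eq hs hσ (z := Complex.exp ((Real.pi / s.card : ℝ) * Complex.I))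
    (Complex.exp_ne_zero _) (by
      rw [hprod, ← Complex.exp_nat_mul]
      have : (s.card : ℂ) * ((Real.pi / s.card : ℝ) * Complex.I) = Real.pi * Complex.I := by
        have : (s.card : ℂ) ≠ 0 := by exact_mod_cast hk.ne'
        push_cast
        field_simp
      rw [this, Complex.exp_pi_mul_I]
      simp)
  rw [Complex.exp_ofReal_mul_I_re] at hre
  have hpi := Real.pi_pos
  refine absurd hre (not_le.2 (Real.cos_pos_of_mem_Ioo ⟨?_, ?_⟩))
  · have : 0 < Real.pi / s.card := by positivity
    linarith
  · rw [div_lt_div_iff₀ hk two_pos]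
    nlinarith

end SignPattern

/-! ### Signs of principal minors under negative cycles -/

namespace SignPattern

/-- The principal submatrix on `α` has a nonzero term in the expansion of its determinant. -/
def Supports {n : ℕ} (P : SignPattern n) (α : Finset (Fin n)) : Prop :=
  ∃ σ : Perm (Fin n), (∀ i, i ∉ α → σ i = i) ∧ ∀ i ∈ α, P (σ i) i ≠ 0

theorem NegativeCycles.prod_eq_neg_one {n : ℕ} {P : SignPattern n} (hP : P.NegativeCycles)
    {σ : Perm (Fin n)} {s : Finset (Fin n)} (hs : s.Nonempty) (hσ : σ.IsCycleOn s)
    (hne : ∀ j ∈ s, P (σ j) j ≠ 0) : ∏ j ∈ s, P (σ j) j = -1 := by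
  have h0 : ∏ j ∈ s, P (σ j) j ≠ 0 := Finset.prod_ne_zero_iff.2 hne
  have h1 := hP σ s hs hσ
  revert h0 h1
  generalize ∏ j ∈ s, P (σ j) j = c
  cases c <;> decide

theorem cast_prod {n : ℕ} (P : SignPattern n) (σ : Perm (Fin n)) (s : Finset (Fin n)) :
    ((∏ j ∈ s, P (σ j) j : SignType) : ℤ) = ∏ j ∈ s, (P (σ j) j : ℤ) :=
  map_prod (SignType.castHom : SignType →*₀ ℤ) _ _

/-- A cycle of length `k` contributes `(-1)^(k-1)` through the sign of the permutation and `-1`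
through its arcs; disjoint cycles multiply. -/
theorem NegativeCycles.sign_mul_prod_support {n : ℕ} {P : SignPattern n} (hP : P.NegativeCycles)
    (σ : Perm (Fin n)) (hne : ∀ i ∈ σ.support, P (σ i) i ≠ 0) :
    (Perm.sign σ : ℤ) * ∏ i ∈ σ.support, (P (σ i) i : ℤ) = (-1) ^ σ.support.card := by
  induction σ using Perm.cycle_induction_on with
  | base_one => simp
  | base_cycles σ hσ =>
    have hon : σ.IsCycleOn (σ.support : Set (Fin n)) := by
      simpa [Perm.coe_support_eq_set_support] using hσ.isCycleOn
    have hsne : σ.support.Nonempty :=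
      Finset.card_pos.1 (by have := hσ.two_le_card_support; omega)
    rw [← cast_prod, hP.prod_eq_neg_one hsne hon hne, hσ.sign]
    simp
  | induction_disjoint σ τ hd hσ ih1 ih2 =>
    have h1 : ∀ i ∈ σ.support, (σ * τ) i = σ i := by
      intro i hi
      rw [Perm.mul_apply, (hd i).resolve_left (Perm.mem_support.1 hi)]
    have h2 : ∀ i ∈ τ.support, (σ * τ) i = τ i := by
      intro i hi
      rw [Perm.mul_apply]
      exact (hd (τ i)).resolve_right (Perm.mem_support.1 (Perm.apply_mem_support.2 hi))
    have hd' := hd.disjoint_support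
    rw [hd.support_mul] at hne ⊢
    rw [Finset.card_union_of_disjoint hd', pow_add, Finset.prod_union hd',
      Finset.prod_congr rfl (g := fun i => (P (σ i) i : ℤ)) (fun i hi => by rw [h1 i hi]),
      Finset.prod_congr (s₁ := τ.support) rfl (g := fun i => (P (τ i) i : ℤ)) (fun i hi => by rw [h2 i hi]),
      ← ih1 fun i hi => by
        simpa [h1 i hi] using hne i (Finset.mem_union_left _ hi),
      ← ih2 fun i hi => by
        simpa [h2 i hi] using hne i (Finset.mem_union_right _ hi)]
    rw [Perm.sign_mul, Units.val_mul]
    ring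

theorem NegativeCycles.sign_mul_prod {n : ℕ} {P : SignPattern n} (hP : P.NegativeCycles)
    {α : Finset (Fin n)} {σ : Perm (Fin n)} (hfix : ∀ i, i ∉ α → σ i = i)
    (hne : ∀ i ∈ α, P (σ i) i ≠ 0) :
    (Perm.sign σ : ℤ) * ∏ i ∈ α, (P (σ i) i : ℤ) = (-1) ^ α.card := by
  have hsub : σ.support ⊆ α := fun i hi => by
    by_contra h
    exact Perm.mem_support.1 hi (hfix i h)
  -- Fixed points of `σ` in `α` are cycles of length one, so each contributes a diagonal entry `-1`.
  rw [← Finset.prod_sdiff hsub, mul_left_comm,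
    hP.sign_mul_prod_support σ fun i hi => hne i (hsub hi),
    ← Finset.card_sdiff_add_card_eq_card hsub, pow_add]
  congr 1
  rw [Finset.prod_congr rfl (g := fun _ => (-1 : ℤ)), Finset.prod_const]
  intro i hi
  rw [Finset.mem_sdiff] at hi
  have hfi : σ i = i := Perm.notMem_support.1 hi.2
  have := hP.prod_eq_neg_one (σ := σ) (s := {i}) (Finset.singleton_nonempty i)
    (by simpa using hfi) (by simpa using hne i hi.1)
  rw [Finset.prod_singleton] at this
  rw [this]
  simp

end SignPattern

theorem principalMinor_eq_sum {n : ℕ} (B : Matrix (Fin n) (Fin n) ℝ) (α : Finset (Fin n)) :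
    principalMinor B α = ∑ τ : Perm α, ((Perm.sign (Perm.ofSubtype τ) : ℤ) : ℝ) *
      ∏ i ∈ α, B (Perm.ofSubtype τ i) i := by
  rw [principalMinor, Matrix.det_apply']
  refine Finset.sum_congr rfl fun τ _ => ?_
  rw [Perm.sign_ofSubtype, ← Finset.prod_coe_sort α]
  congr 1
  refine Finset.prod_congr rfl fun i _ => ?_
  simp

namespace SignPattern

theorem mem_qualClass_apply_eq {n : ℕ} {P : SignPattern n} {B : Matrix (Fin n) (Fin n) ℝ}
    (hB : B ∈ P.qualClass) (i j : Fin n) : B i j = (P i j : ℝ) * |B i j| := by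
  rw [← hB i j, sign_mul_abs]

theorem mem_qualClass_apply_ne_zero {n : ℕ} {P : SignPattern n} {B : Matrix (Fin n) (Fin n) ℝ}
    (hB : B ∈ P.qualClass) (i j : Fin n) : B i j ≠ 0 ↔ P i j ≠ 0 := by
  rw [← hB i j, sign_ne_zero]

theorem NegativeCycles.signed_term {n : ℕ} {P : SignPattern n} (hP : P.NegativeCycles)
    {B : Matrix (Fin n) (Fin n) ℝ} (hB : B ∈ P.qualClass) {α : Finset (Fin n)}
    {σ : Perm (Fin n)} (hfix : ∀ i, i ∉ α → σ i = i) :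
    (-1) ^ α.card * (((Perm.sign σ : ℤ) : ℝ) * ∏ i ∈ α, B (σ i) i) = ∏ i ∈ α, |B (σ i) i| := by
  by_cases hne : ∀ i ∈ α, P (σ i) i ≠ 0
  · have h := congrArg (Int.cast : ℤ → ℝ) (hP.sign_mul_prod hfix hne)
    push_cast at h
    rw [Finset.prod_congr rfl (fun i _ => mem_qualClass_apply_eq hB (σ i) i),
      Finset.prod_mul_distrib, ← mul_assoc, ← mul_assoc, mul_assoc ((-1) ^ _), h, ← mul_pow]
    simp
  · push Not at hne
    obtain ⟨i, hi, h0⟩ := hne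
    have hBi : B (σ i) i = 0 := by
      by_contra h
      exact (mem_qualClass_apply_ne_zero hB _ _).1 h h0
    rw [Finset.prod_eq_zero (f := fun i => B (σ i) i) hi hBi,
      Finset.prod_eq_zero (f := fun i => |B (σ i) i|) hi (by rw [hBi, abs_zero])]
    simp

theorem NegativeCycles.signed_minor {n : ℕ} {P : SignPattern n} (hP : P.NegativeCycles)
    {B : Matrix (Fin n) (Fin n) ℝ} (hB : B ∈ P.qualClass) (α : Finset (Fin n)) :
    (-1) ^ α.card * principalMinor B α =
      ∑ τ : Perm α, ∏ i ∈ α, |B (Perm.ofSubtype τ i) i| := by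
  rw [principalMinor_eq_sum, Finset.mul_sum]
  exact Finset.sum_congr rfl fun τ _ =>
    hP.signed_term hB fun i hi => Perm.ofSubtype_apply_of_not_mem τ hi

theorem NegativeCycles.signed_minor_pos {n : ℕ} {P : SignPattern n} (hP : P.NegativeCycles)
    {B : Matrix (Fin n) (Fin n) ℝ} (hB : B ∈ P.qualClass) {α : Finset (Fin n)}
    (hα : P.Supports α) : 0 < (-1) ^ α.card * principalMinor B α := by
  obtain ⟨σ, hfix, hne⟩ := hα
  rw [hP.signed_minor hB]
  have hmem : ∀ i, i ∈ α ↔ σ i ∈ α := by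
    intro i
    constructor
    · intro hi
      by_contra h
      exact h (by rwa [σ.injective (hfix _ h)])
    · intro hi
      by_contra h
      exact h (by rwa [hfix i h] at hi)
  refine Finset.sum_pos' (fun τ _ => Finset.prod_nonneg fun i _ => abs_nonneg _)
    ⟨σ.subtypePerm (p := fun i => i ∈ α) (fun i => (hmem i).symm), Finset.mem_univ _, ?_⟩
  refine Finset.prod_pos fun i hi => ?_
  rw [abs_pos, Perm.ofSubtype_apply_of_mem _ hi]
  exact (mem_qualClass_apply_ne_zero hB _ _).2 (hne i hi)

theorem NegativeCycles.minor_eq_zero {n : ℕ} {P : SignPattern n} (hP : P.NegativeCycles)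
    {B : Matrix (Fin n) (Fin n) ℝ} (hB : B ∈ P.qualClass) {α : Finset (Fin n)}
    (hα : ¬ P.Supports α) : principalMinor B α = 0 := by
  have h := hP.signed_minor hB α
  rw [Finset.sum_eq_zero] at h
  · simpa using h
  intro τ _
  by_contra h0
  rw [← ne_eq, Finset.prod_ne_zero_iff] at h0
  refine hα ⟨Perm.ofSubtype τ, fun i hi => Perm.ofSubtype_apply_of_not_mem τ hi, fun i hi => ?_⟩
  exact (mem_qualClass_apply_ne_zero hB _ _).1 (abs_ne_zero.1 (h0 i hi))

/-- Both minors have sign `(-1)^card` if `α` is supported and vanish otherwise. With `R = P` this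
gives uniqueness of the sequence. -/
theorem NegativeCycles.sign_minor_congr {n : ℕ} {P R : SignPattern n} (hP : P.NegativeCycles)
    (hR : R.NegativeCycles) (hPR : ∀ α, P.Supports α ↔ R.Supports α)
    {B C : Matrix (Fin n) (Fin n) ℝ} (hB : B ∈ P.qualClass) (hC : C ∈ R.qualClass)
    (α : Finset (Fin n)) :
    SignType.sign (principalMinor B α) = SignType.sign (principalMinor C α) := by
  by_cases hα : P.Supports α
  · have h1 := hP.signed_minor_pos hB hα
    have h2 := hR.signed_minor_pos hC ((hPR α).1 hα)
    rcases neg_one_pow_eq_or ℝ α.card with h | h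
    · rw [h, one_mul] at h1 h2
      rw [sign_pos h1, sign_pos h2]
    · rw [h, neg_one_mul, neg_pos] at h1 h2
      rw [sign_neg h1, sign_neg h2]
  · rw [hP.minor_eq_zero hB hα, hR.minor_eq_zero hC (mt (hPR α).2 hα)]

end SignPattern

theorem matrixSepr_congr {n : ℕ} {B C : Matrix (Fin n) (Fin n) ℝ}
    (h : ∀ α, SignType.sign (principalMinor B α) = SignType.sign (principalMinor C α)) :
    matrixSepr B = matrixSepr C := by
  have hpos : HasPosMinor B = HasPosMinor C := funext fun k => propext <|
    exists_congr fun α => and_congr_right fun _ => by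
      rw [← sign_eq_one_iff, h, sign_eq_one_iff]
  have hneg : HasNegMinor B = HasNegMinor C := funext fun k => propext <|
    exists_congr fun α => and_congr_right fun _ => by
      rw [← sign_eq_neg_one_iff, h, sign_eq_neg_one_iff]
  have hzero : HasZeroMinor B = HasZeroMinor C := funext fun k => propext <|
    exists_congr fun α => and_congr_right fun _ => by
      rw [← sign_eq_zero_iff, h, sign_eq_zero_iff]
  unfold matrixSepr seprTerm
  rw [hpos, hneg, hzero]

namespace SignPattern

/-- The qualitative class is nonempty. -/
theorem qualClass_nonempty {n : ℕ} (P : SignPattern n) : P.qualClass.Nonempty := by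
  refine ⟨Matrix.of fun i j => (P i j : ℝ), fun i j => ?_⟩
  rw [Matrix.of_apply]
  cases P i j <;> simp

theorem NegativeCycles.hasUniqueSepr {n : ℕ} {P : SignPattern n} (hP : P.NegativeCycles) :
    P.HasUniqueSepr := by
  obtain ⟨B, hB⟩ := P.qualClass_nonempty
  refine ⟨matrixSepr B, ⟨B, hB, rfl⟩, ?_⟩
  rintro _ ⟨C, hC, rfl⟩
  exact matrixSepr_congr (hP.sign_minor_congr hP (fun _ => Iff.rfl) hC hB)

theorem matrixSepr_eq_sepr {n : ℕ} {P : SignPattern n} (h : P.HasUniqueSepr)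
    {B : Matrix (Fin n) (Fin n) ℝ} (hB : B ∈ P.qualClass) : matrixSepr B = P.sepr h :=
  h.unique ⟨B, hB, rfl⟩ h.choose_spec.1

theorem NegativeCycles.sepr_congr {n : ℕ} {P R : SignPattern n} (hP : P.NegativeCycles)
    (hR : R.NegativeCycles) (hPR : ∀ α, P.Supports α ↔ R.Supports α) (hp : P.HasUniqueSepr)
    (hr : R.HasUniqueSepr) : R.sepr hr = P.sepr hp := by
  obtain ⟨B, hB⟩ := P.qualClass_nonempty
  obtain ⟨C, hC⟩ := R.qualClass_nonempty
  rw [← matrixSepr_eq_sepr hp hB, ← matrixSepr_eq_sepr hr hC]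
  exact (matrixSepr_congr (hP.sign_minor_congr hR hPR hB hC)).symm

end SignPattern

/-! ### Vanishing minors of order at least three force semi-stability -/

/-- The real part of a root of a reversed quadratic with nonnegative coefficients. -/
theorem Complex.re_nonneg_of_quadratic_eq_zero {a b : ℝ} (ha : a ≤ 0) (hb : 0 ≤ b) {w : ℂ}
    (h : 1 + a * w + b * w ^ 2 = 0) : 0 ≤ w.re := by
  by_contra! hw
  have hr := congrArg Complex.re h
  have hi := congrArg Complex.im h
  simp [pow_two] at hr hi
  -- The imaginary part factors. If `w` is real and negative, all three terms are nonnegative and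
  -- the first is `1`; otherwise two nonpositive summands add up to zero, so `a = b = 0` and `1 =
  -- 0`.
  have hi' : w.im * (a + 2 * b * w.re) = 0 := by linarith
  rcases mul_eq_zero.1 hi' with h0 | h0
  · rw [h0] at hr
    nlinarith [mul_nonneg hb (mul_self_nonneg w.re), mul_nonneg_of_nonpos_of_nonpos ha hw.le]
  · have h1 : b * w.re ≤ 0 := mul_nonpos_of_nonneg_of_nonpos hb hw.le
    have h2 : a = 0 := by linarith
    have h3 : b * w.re = 0 := by linarith
    have h4 : b = 0 := (mul_eq_zero.1 h3).resolve_right hw.ne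
    rw [h2, h4] at hr
    simp at hr

/-- The coefficients of `det (1 + X M)` are the sums of principal minors of each order, so this
determinant is `1 + E 1 * X + E 2 * X ^ 2`. -/
theorem isSemiStable_of_principalMinor {n : ℕ} {B : Matrix (Fin n) (Fin n) ℝ}
    (h1 : ∀ α : Finset (Fin n), α.card = 1 → principalMinor B α ≤ 0)
    (h2 : ∀ α : Finset (Fin n), α.card = 2 → 0 ≤ principalMinor B α)
    (h3 : ∀ α : Finset (Fin n), 3 ≤ α.card → principalMinor B α = 0) : IsSemiStable B := by
  rw [isSemiStable_iff_charpoly]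
  intro z hz
  by_cases hz0 : z = 0
  · simp [hz0]
  set M := B.map (fun x : ℝ => (x : ℂ)) with hM
  set p : Polynomial ℂ := (1 + (Polynomial.X : Polynomial ℂ) • M.map Polynomial.C).det with hp
  let E : ℕ → ℝ := fun k => ∑ α ∈ Finset.univ.powersetCard k, principalMinor B α
  have hcoeff : ∀ k, p.coeff k = (E k : ℂ) := by
    intro k
    rw [hp, Matrix.coeff_det_one_add_X_smul_eq_sum_minors, Complex.ofReal_sum]
    refine Finset.sum_congr rfl fun α _ => ?_
    rw [principalMinor]
    exact (RingHom.map_det Complex.ofRealHom _).symm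
  have hE0 : E 0 = 1 := by simp [E, principalMinor]
  have hE1 : E 1 ≤ 0 :=
    Finset.sum_nonpos fun α hα => h1 α (Finset.mem_powersetCard.1 hα).2
  have hE2 : 0 ≤ E 2 :=
    Finset.sum_nonneg fun α hα => h2 α (Finset.mem_powersetCard.1 hα).2
  have hE3 : ∀ k, 3 ≤ k → E k = 0 := fun k hk =>
    Finset.sum_eq_zero fun α hα => h3 α (by rw [(Finset.mem_powersetCard.1 hα).2]; exact hk)
  have hpoly : p = 1 + Polynomial.C (E 1 : ℂ) * Polynomial.X +
      Polynomial.C (E 2 : ℂ) * Polynomial.X ^ 2 := by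
    ext k
    rw [hcoeff]
    rcases k with _ | _ | _ | k
    · simp [hE0]
    · simp [Polynomial.coeff_one, Polynomial.coeff_X_pow]
    · simp [Polynomial.coeff_one]
    · rw [hE3 _ (by omega)]
      simp [Polynomial.coeff_one]
  -- From `z - M = z (1 + (-1/z) M)`, nonzero eigenvalues `z` correspond to roots `-1/z`.
  have heval : p.eval (-z⁻¹) = 0 := by
    rw [hp, ← Polynomial.coe_evalRingHom, RingHom.map_det]
    rw [Matrix.eval_charpoly] at hz
    have hfac : Matrix.scalar (Fin n) z - M = z • ((Polynomial.evalRingHom (-z⁻¹)).mapMatrix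
        (1 + (Polynomial.X : Polynomial ℂ) • M.map Polynomial.C)) := by
      ext i j
      by_cases hij : i = j
      · subst hij
        simp
        field_simp
        ring
      · simp [hij]
        field_simp
    rw [hfac, Matrix.det_smul] at hz
    exact (mul_eq_zero.1 hz).resolve_left (pow_ne_zero _ hz0)
  rw [hpoly] at heval
  simp only [Polynomial.eval_add, Polynomial.eval_one, Polynomial.eval_mul, Polynomial.eval_C,
    Polynomial.eval_X, Polynomial.eval_pow] at heval
  have hw := Complex.re_nonneg_of_quadratic_eq_zero hE1 hE2 heval
  rw [Complex.neg_re, Complex.inv_re] at hw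
  by_contra! hre
  have : 0 < z.re / Complex.normSq z := div_pos hre (Complex.normSq_pos.2 hz0)
  linarith

theorem hasMinor_trichotomy {n : ℕ} (B : Matrix (Fin n) (Fin n) ℝ) {k : ℕ} (hk : k ≤ n) :
    HasZeroMinor B k ∨ HasPosMinor B k ∨ HasNegMinor B k := by
  obtain ⟨α, -, hα⟩ := Finset.exists_subset_card_eq (s := (Finset.univ : Finset (Fin n)))
    (n := k) (by simpa using hk)
  rcases lt_trichotomy (principalMinor B α) 0 with h | h | h
  · exact Or.inr (Or.inr ⟨α, hα, h⟩)
  · exact Or.inl ⟨α, hα, h⟩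
  · exact Or.inr (Or.inl ⟨α, hα, h⟩)

/-- Since `Aminus` is the default branch of `seprTerm`, it guarantees a negative minor only when
some minor of order `k` exists; hence `k ≤ n`. -/
theorem hasPosMinor_and_hasNegMinor_congr {n : ℕ} {B C : Matrix (Fin n) (Fin n) ℝ} {k : ℕ}
    (hk : k ≤ n) (h : seprTerm B k = seprTerm C k) :
    (HasPosMinor B k ↔ HasPosMinor C k) ∧ (HasNegMinor B k ↔ HasNegMinor C k) := by
  have hB := hasMinor_trichotomy B hk
  have hC := hasMinor_trichotomy C hk
  unfold seprTerm at h
  split_ifs at h <;> simp_all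

theorem seprTerm_eq_N_iff {n : ℕ} {B : Matrix (Fin n) (Fin n) ℝ} {k : ℕ} (hk : k ≤ n) :
    seprTerm B k = SeprSymbol.N ↔ ∀ α : Finset (Fin n), α.card = k → principalMinor B α = 0 := by
  have hB := hasMinor_trichotomy B hk
  have : (∀ α : Finset (Fin n), α.card = k → principalMinor B α = 0) ↔
      ¬ HasPosMinor B k ∧ ¬ HasNegMinor B k := by
    constructor
    · intro h
      exact ⟨fun ⟨α, hα, h0⟩ => h0.ne' (h α hα), fun ⟨α, hα, h0⟩ => h0.ne (h α hα)⟩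
    · rintro ⟨h1, h2⟩ α hα
      by_contra h0
      rcases lt_or_gt_of_ne h0 with h | h
      · exact h2 ⟨α, hα, h⟩
      · exact h1 ⟨α, hα, h⟩
  rw [this]
  unfold seprTerm
  split_ifs <;> simp_all

theorem matrixSepr_getElem? {n : ℕ} (B : Matrix (Fin n) (Fin n) ℝ) {k : ℕ} (hk : 1 ≤ k)
    (hkn : k ≤ n) : (matrixSepr B)[k - 1]? = some (seprTerm B k) := by
  have h : k - 1 < n := by omega
  simp [matrixSepr, h, Nat.sub_add_cancel hk]

namespace SignPattern

/-- A positive minor of order one or a negative minor of order two in `C` would, by equality of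
symbols, occur in `B` too, where negative cycles exclude it. -/
theorem NegativeCycles.isSemiStable_of_matrixSepr_eq {n : ℕ} {P : SignPattern n}
    (hP : P.NegativeCycles) {B C : Matrix (Fin n) (Fin n) ℝ} (hB : B ∈ P.qualClass)
    (hBC : matrixSepr C = matrixSepr B)
    (hN : ∀ k, 3 ≤ k → k ≤ n → seprTerm B k = SeprSymbol.N) : IsSemiStable C := by
  have hterm : ∀ k, 1 ≤ k → k ≤ n → seprTerm C k = seprTerm B k := by
    intro k hk hkn
    have h := congrArg (fun l : List SeprSymbol => l[k - 1]?) hBC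
    simp only [matrixSepr_getElem? _ hk hkn, Option.some.injEq] at h
    exact h
  have hle : ∀ α : Finset (Fin n), α.card ≤ n := fun α => by
    simpa using Finset.card_le_univ α
  have hsigned : ∀ α : Finset (Fin n), 0 ≤ (-1) ^ α.card * principalMinor B α := by
    intro α
    by_cases hα : P.Supports α
    · exact (hP.signed_minor_pos hB hα).le
    · rw [hP.minor_eq_zero hB hα, mul_zero]
  refine isSemiStable_of_principalMinor ?_ ?_ ?_
  · intro α hα
    have hcongr := (hasPosMinor_and_hasNegMinor_congr (hα ▸ hle α)
      (hterm 1 le_rfl (hα ▸ hle α))).1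
    by_contra! h
    obtain ⟨β, hβ, hpos⟩ := hcongr.1 ⟨α, hα, h⟩
    have := hsigned β
    rw [hβ] at this
    linarith
  · intro α hα
    have hcongr := (hasPosMinor_and_hasNegMinor_congr (hα ▸ hle α)
      (hterm 2 (by norm_num) (hα ▸ hle α))).2
    by_contra! h
    obtain ⟨β, hβ, hneg⟩ := hcongr.1 ⟨α, hα, h⟩
    have := hsigned β
    rw [hβ] at this
    linarith
  · intro α hα
    have h := (hterm α.card (by omega) (hle α)).trans (hN α.card hα (hle α))
    exact (seprTerm_eq_N_iff (hle α)).1 h α rfl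

/-- If a semi-stable pattern supports no set with more than two elements, every sign pattern with
the same sepr-sequence is sign semi-stable. -/
theorem NegativeCycles.isSignSemiStable_of_sepr_eq {n m : ℕ} {P : SignPattern n}
    (hP : P.NegativeCycles) (hp : P.HasUniqueSepr)
    (hN : (∀ k : ℕ, 3 ≤ k → k ≤ n → (P.sepr hp)[k - 1]? = some SeprSymbol.N) ∨ n ≤ 2)
    {R : SignPattern m} (hR : R.HasUniqueSepr) (h : R.sepr hR = P.sepr hp) :
    R.IsSignSemiStable := by
  intro C hC
  obtain ⟨B, hB⟩ := P.qualClass_nonempty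
  rw [← matrixSepr_eq_sepr hR hC, ← matrixSepr_eq_sepr hp hB] at h
  -- The order of a pattern is the length of its sequence.
  have hmn : m = n := by simpa [matrixSepr] using congrArg List.length h
  subst hmn
  refine hP.isSemiStable_of_matrixSepr_eq hB h fun k hk hkn => ?_
  rcases hN with hN | hN
  · have := hN k hk hkn
    rw [← matrixSepr_eq_sepr hp hB, matrixSepr_getElem? B (by omega) hkn] at this
    exact Option.some.inj this
  · omega

theorem NegativeCycles.exists_supports_of_sepr_ne {n : ℕ} {P : SignPattern n}
    (hP : P.NegativeCycles) (hp : P.HasUniqueSepr)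
    (hN : ¬ ∀ k : ℕ, 3 ≤ k → k ≤ n → (P.sepr hp)[k - 1]? = some SeprSymbol.N) :
    ∃ α : Finset (Fin n), 3 ≤ α.card ∧ P.Supports α := by
  push Not at hN
  obtain ⟨k, hk, hkn, h⟩ := hN
  obtain ⟨B, hB⟩ := P.qualClass_nonempty
  rw [← matrixSepr_eq_sepr hp hB, matrixSepr_getElem? B (by omega) hkn, ne_eq,
    Option.some.injEq, seprTerm_eq_N_iff hkn] at h
  push Not at h
  obtain ⟨α, hα, h0⟩ := h
  refine ⟨α, by omega, ?_⟩
  by_contra hs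
  exact h0 (hP.minor_eq_zero hB hs)

end SignPattern

/-! ### Cycles of permutations in forests -/

theorem Equiv.Perm.isCycleOn_sameCycle {α : Type*} (σ : Perm α) (a : α) :
    σ.IsCycleOn {x | σ.SameCycle a x} := by
  refine ⟨σ.bijOn fun x => ?_, fun x hx y hy => hx.symm.trans hy⟩
  exact Perm.sameCycle_apply_right

theorem Equiv.Perm.exists_isCycleOn_mem_subset {α : Type*} [Fintype α] {σ : Perm α} {s : Finset α}
    (hfix : ∀ i, i ∉ s → σ i = i) {a : α} (ha : a ∈ s) :
    ∃ t : Finset α, a ∈ t ∧ t ⊆ s ∧ σ.IsCycleOn t := by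
  classical
  refine ⟨Finset.univ.filter fun x => σ.SameCycle a x, by simp [Perm.SameCycle.refl], fun x hx => ?_, ?_⟩
  · have hx' : σ.SameCycle a x := by simpa using hx
    by_contra h
    obtain rfl : a = x := by
      obtain ⟨k, hk⟩ := hx'.symm
      rw [← hk, Perm.zpow_apply_eq_self_of_apply_eq_self (hfix x h)]
    exact h ha
  · simpa using σ.isCycleOn_sameCycle a

theorem Equiv.Perm.IsCycleOn.apply_apply_eq {α : Type*} {σ : Perm α} {s : Finset α}
    (hσ : σ.IsCycleOn s) (hs : s.card ≤ 2) {a : α} (ha : a ∈ s) : σ (σ a) = a := by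
  have hpos : 0 < s.card := Finset.card_pos.2 ⟨a, ha⟩
  have h : s.card ∣ 2 := by
    rcases (show s.card = 1 ∨ s.card = 2 by omega) with h | h <;> simp [h]
  simpa [pow_two] using (hσ.pow_apply_eq ha).2 h

namespace SimpleGraph

variable {V : Type*} {G : SimpleGraph V}

/-- A cycle of a permutation all of whose arcs but one are edges of a graph is a path. -/
theorem exists_isPath_of_isCycleOn {σ : Perm V} {s : Finset V} (hσ : σ.IsCycleOn s) {e : V}
    (he : e ∈ s) (h : ∀ j ∈ s, j ≠ e → G.Adj j (σ j)) :
    ∃ p : G.Walk (σ e) e, p.IsPath ∧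
      p.support = (List.range s.card).map fun m => (σ ^ m) (σ e) := by
  have hpos : 0 < s.card := Finset.card_pos.2 ⟨e, he⟩
  have hσe : σ e ∈ s := hσ.1.mapsTo he
  have key : ∀ m, m < s.card → ∃ p : G.Walk (σ e) ((σ ^ m) (σ e)),
      p.support = (List.range (m + 1)).map fun m => (σ ^ m) (σ e) := by
    intro m
    induction m with
    | zero => exact fun _ => ⟨Walk.nil, rfl⟩
    | succ m ih =>
      intro hm
      obtain ⟨p, hp⟩ := ih (by omega)
      have hne : (σ ^ m) (σ e) ≠ e := by
        intro h0
        rw [← Perm.mul_apply, ← pow_succ, hσ.pow_apply_eq he] at h0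
        exact absurd (Nat.le_of_dvd (by omega) h0) (by omega)
      have hadj : G.Adj ((σ ^ m) (σ e)) ((σ ^ (m + 1)) (σ e)) := by
        rw [pow_succ', Perm.mul_apply]
        exact h _ ((hσ.1.perm_pow m).mapsTo hσe) hne
      exact ⟨p.concat hadj, by rw [Walk.support_concat, hp, List.range_succ (n := m + 1)]; simp⟩
  obtain ⟨p, hp⟩ := key (s.card - 1) (by omega)
  have hlast : (σ ^ (s.card - 1)) (σ e) = e := by
    rw [← Perm.mul_apply, ← pow_succ, Nat.sub_add_cancel hpos, hσ.pow_card_apply he]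
  rw [Nat.sub_add_cancel hpos] at hp
  refine ⟨p.copy rfl hlast, ?_, by simpa using hp⟩
  rw [Walk.isPath_def, Walk.support_copy, hp]
  refine List.Nodup.map_on ?_ List.nodup_range
  intro m hm m' hm' hmm
  rw [hσ.pow_apply_eq_pow_apply hσe] at hmm
  exact Nat.ModEq.eq_of_lt_of_lt hmm (List.mem_range.1 hm) (List.mem_range.1 hm')

/-- In a forest, at most one cycle can be closed by a given arc. -/
theorem IsAcyclic.isCycleOn_unique (hG : G.IsAcyclic) {σ τ : Perm V} {s t : Finset V}
    (hσ : σ.IsCycleOn s) (hτ : τ.IsCycleOn t) {e : V} (hes : e ∈ s) (het : e ∈ t)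
    (heq : σ e = τ e) (hs : ∀ j ∈ s, j ≠ e → G.Adj j (σ j))
    (ht : ∀ j ∈ t, j ≠ e → G.Adj j (τ j)) : s = t ∧ ∀ j ∈ s, σ j = τ j := by
  obtain ⟨p, hp, hps⟩ := exists_isPath_of_isCycleOn hσ hes hs
  obtain ⟨q, hq, hqs⟩ := exists_isPath_of_isCycleOn hτ het ht
  have hsupp : p.support = q.support := by
    have hcopy : p = q.copy heq.symm rfl :=
      congrArg Subtype.val ((hG.subsingleton_path _ _).elim ⟨p, hp⟩
        ⟨q.copy heq.symm rfl, by simpa using hq⟩)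
    rw [hcopy, Walk.support_copy]
  rw [hps, hqs] at hsupp
  have hcard : s.card = t.card := by simpa using congrArg List.length hsupp
  rw [← hcard, List.map_inj_left] at hsupp
  have hiter : ∀ m < s.card, (σ ^ m) (σ e) = (τ ^ m) (τ e) := fun m hm =>
    hsupp m (List.mem_range.2 hm)
  have hσe : σ e ∈ s := hσ.1.mapsTo hes
  have hτe : τ e ∈ t := hτ.1.mapsTo het
  constructor
  · refine Finset.eq_of_subset_of_card_le (fun j hj => ?_) hcard.ge
    obtain ⟨m, hm, rfl⟩ := hσ.exists_pow_eq hσe hj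
    rw [hiter m hm]
    exact (hτ.1.perm_pow m).mapsTo hτe
  · intro j hj
    obtain ⟨m, hm, rfl⟩ := hσ.exists_pow_eq hσe hj
    by_cases hm' : m + 1 < s.card
    · rw [← Perm.mul_apply σ, ← pow_succ', hiter _ hm', hiter _ hm, pow_succ', Perm.mul_apply]
    · have hlast : (σ ^ m) (σ e) = e := by
        rw [← Perm.mul_apply, ← pow_succ, show m + 1 = s.card by omega, hσ.pow_card_apply hes]
      rw [hlast, heq]

/-- Going round the cycle from `σ e` to `e` gives a path through all of `s`; in a forest it must
coincide with the single edge between them. -/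
theorem IsAcyclic.card_le_two_of_isCycleOn (hG : G.IsAcyclic) {σ : Perm V} {s : Finset V}
    (hσ : σ.IsCycleOn s) (h : ∀ j ∈ s, σ j = j ∨ G.Adj j (σ j)) : s.card ≤ 2 := by
  by_contra! hcard
  obtain ⟨e, he⟩ : s.Nonempty := Finset.card_pos.1 (by omega)
  have hadj : ∀ j ∈ s, G.Adj j (σ j) := fun j hj =>
    (h j hj).resolve_left (hσ.apply_ne (Finset.one_lt_card_iff_nontrivial.1 (by omega)) hj)
  obtain ⟨p, hp, hps⟩ := exists_isPath_of_isCycleOn hσ he fun j hj _ => hadj j hj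
  have hpath := congrArg Subtype.val
    ((hG.subsingleton_path _ _).elim ⟨p, hp⟩ (Path.singleton (hadj e he).symm))
  have hlen := congrArg (fun w => w.support.length) hpath
  simp only [hps, List.length_map, List.length_range] at hlen
  simp [Path.singleton] at hlen
  omega

end SimpleGraph

/-! ### Adding one long negative cycle to the forest of 2-cycles -/

namespace SignPattern

variable {n : ℕ}

/-- The graph whose edges are the cycles of length two of a sign pattern. -/
def graph (P : SignPattern n) : SimpleGraph (Fin n) where
  Adj i j := i ≠ j ∧ P i j ≠ 0 ∧ P j i ≠ 0
  symm := ⟨fun _ _ h => ⟨h.1.symm, h.2.2, h.2.1⟩⟩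
  loopless := ⟨fun _ h => h.1 rfl⟩

/-- A cycle of the graph, traversed in one direction, is a cycle of the pattern of length at least
three. -/
theorem ShortCycles.isAcyclic_graph {P : SignPattern n} (hP : P.ShortCycles) :
    P.graph.IsAcyclic := by
  rw [SimpleGraph.isAcyclic_iff_free_cycleGraph]
  rintro k hk ⟨f⟩
  obtain ⟨k, rfl⟩ := Nat.exists_eq_add_of_le' hk
  have hnd : (List.ofFn f).Nodup := List.nodup_ofFn.2 f.injective
  have hcyc := hnd.isCycleOn_formPerm
  have hset : {a | a ∈ List.ofFn f} = ((List.ofFn f).toFinset : Set (Fin n)) := by ext; simp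
  rw [hset] at hcyc
  have hle := hP _ _ ⟨f 0, by simp⟩ hcyc fun j hj => by
    rw [List.mem_toFinset, List.mem_iff_getElem] at hj
    obtain ⟨i, hi, rfl⟩ := hj
    rw [List.formPerm_apply_getElem _ hnd]
    have hi' : i < k + 3 := by rwa [List.length_ofFn] at hi
    have hadj : (SimpleGraph.cycleGraph (k + 3)).Adj ⟨(i + 1) % (k + 3), Nat.mod_lt _ (by omega)⟩
        ⟨i, hi'⟩ := by
      rw [SimpleGraph.cycleGraph_adj]
      left
      rw [sub_eq_iff_eq_add]
      ext
      simp [Fin.val_add, add_comm]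
    have h := (f.toHom.map_adj hadj).2.1
    simp only [List.getElem_ofFn, List.length_ofFn]
    exact h
  rw [List.toFinset_card_of_nodup hnd, List.length_ofFn] at hle
  omega

/-- The sign pattern obtained by deleting the arcs which are not on a cycle of length at most
two. -/
def symmPart (P : SignPattern n) : SignPattern n :=
  Matrix.of fun i j => if P j i = 0 then 0 else P i j

theorem symmPart_ne_zero {P : SignPattern n} {i j : Fin n} :
    P.symmPart i j ≠ 0 ↔ P i j ≠ 0 ∧ P j i ≠ 0 := by
  simp only [symmPart, Matrix.of_apply]
  split_ifs <;> simp_all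

theorem symmPart_ne_zero_comm {P : SignPattern n} {i j : Fin n} :
    P.symmPart i j ≠ 0 ↔ P.symmPart j i ≠ 0 := by
  rw [symmPart_ne_zero, symmPart_ne_zero, and_comm]

theorem symmPart_apply_of_ne_zero {P : SignPattern n} {i j : Fin n} (h : P.symmPart i j ≠ 0) :
    P.symmPart i j = P i j := by
  simp only [symmPart, Matrix.of_apply, if_neg (symmPart_ne_zero.1 h).2]

theorem eq_or_adj_of_symmPart_ne_zero {P : SignPattern n} {i j : Fin n}
    (h : P.symmPart i j ≠ 0) : i = j ∨ P.graph.Adj j i := by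
  rw [symmPart_ne_zero] at h
  by_cases hij : i = j
  · exact Or.inl hij
  · exact Or.inr ⟨Ne.symm hij, h.2, h.1⟩

/-- The sign pattern obtained from the symmetric part of `P` by adding the arcs of `τ` on `C`, with
signs chosen such that the new cycle is negative. -/
def addCycle (P : SignPattern n) (τ : Perm (Fin n)) (C : Finset (Fin n)) (e : Fin n) :
    SignPattern n :=
  Matrix.of fun i j =>
    if j ∈ C ∧ i = τ j ∧ P.symmPart i j = 0 then
      -- Every other added arc gets `+`, so the factors `1` below are the actual new entries and the
      -- arc at `e` makes the whole product `-`.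
      if j = e then
        -∏ k ∈ C.erase e, if P.symmPart (τ k) k = 0 then 1 else P.symmPart (τ k) k
      else 1
    else P.symmPart i j

section AddCycle

variable {P : SignPattern n} {τ : Perm (Fin n)} {C : Finset (Fin n)} {e : Fin n}

theorem addCycle_of_symmPart_ne_zero {i j : Fin n} (h : P.symmPart i j ≠ 0) :
    P.addCycle τ C e i j = P.symmPart i j := by
  simp [addCycle, h]

theorem symmPart_ne_zero_or_of_addCycle_ne_zero {i j : Fin n} (h : P.addCycle τ C e i j ≠ 0) :
    P.symmPart i j ≠ 0 ∨ (j ∈ C ∧ i = τ j) := by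
  by_contra! hcon
  refine h ?_
  simp only [addCycle, Matrix.of_apply, hcon.1]
  rw [if_neg]
  rintro ⟨h1, h2, -⟩
  exact hcon.2 h1 h2

/-- If the closing arc were already present, `τ` would be a cycle of length at least three inside a
forest. So its sign is free to be chosen. -/
theorem symmPart_closing_arc_eq_zero {G : SimpleGraph (Fin n)} (hG : G.IsAcyclic)
    (hPG : P.graph ≤ G) (hC : 3 ≤ C.card) (hτ : τ.IsCycleOn C)
    (hadj : ∀ j ∈ C, j ≠ e → G.Adj j (τ j)) : P.symmPart (τ e) e = 0 := by
  by_contra h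
  have := hG.card_le_two_of_isCycleOn hτ fun j hj => by
    by_cases hje : j = e
    · subst hje
      exact (eq_or_adj_of_symmPart_ne_zero h).imp_right fun h => hPG h
    · exact Or.inr (hadj j hj hje)
  omega

theorem prod_addCycle (he : e ∈ C) (h0 : P.symmPart (τ e) e = 0) :
    ∏ j ∈ C, P.addCycle τ C e (τ j) j = -1 := by
  rw [← Finset.mul_prod_erase C _ he]
  have h1 : ∏ j ∈ C.erase e, P.addCycle τ C e (τ j) j =
      ∏ k ∈ C.erase e, if P.symmPart (τ k) k = 0 then 1 else P.symmPart (τ k) k := by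
    refine Finset.prod_congr rfl fun j hj => ?_
    rw [Finset.mem_erase] at hj
    simp [addCycle, hj.1, hj.2]
  have h2 : (∏ k ∈ C.erase e, if P.symmPart (τ k) k = 0 then 1 else P.symmPart (τ k) k) ≠ 0 := by
    rw [Finset.prod_ne_zero_iff]
    intro k _
    split_ifs with h
    · decide
    · exact h
  rw [h1]
  simp only [addCycle, Matrix.of_apply, he, h0, and_self, if_true]
  revert h2
  generalize (∏ k ∈ C.erase e, if P.symmPart (τ k) k = 0 then 1 else P.symmPart (τ k) k) = c
  cases c <;> decide

variable {G : SimpleGraph (Fin n)}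

/-- The cycles of `addCycle`: the short cycles of `P` and the new one. -/
theorem addCycle_cycle (hG : G.IsAcyclic)
    (hPG : P.graph ≤ G) (hC : 3 ≤ C.card) (hτ : τ.IsCycleOn C) (he : e ∈ C)
    (hadj : ∀ j ∈ C, j ≠ e → G.Adj j (τ j)) {σ : Perm (Fin n)} {s : Finset (Fin n)}
    (hσ : σ.IsCycleOn s) (hne : ∀ j ∈ s, P.addCycle τ C e (σ j) j ≠ 0) :
    (∀ j ∈ s, P.symmPart (σ j) j ≠ 0) ∨ (s = C ∧ ∀ j ∈ s, σ j = τ j) := by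
  have harc : ∀ j ∈ s, (j = e → σ j ≠ τ j) → σ j = j ∨ G.Adj j (σ j) := by
    intro j hj hje
    rcases symmPart_ne_zero_or_of_addCycle_ne_zero (hne j hj) with h | ⟨hjC, hjτ⟩
    · exact (eq_or_adj_of_symmPart_ne_zero h).imp_right fun h => hPG h
    · right
      rw [hjτ]
      exact hadj j hjC fun h => hje h hjτ
  -- A cycle using the closing arc is the new one, by uniqueness of paths in `G`. Any other has only
  -- loops and `G`-edges as arcs, so its length is at most two; an added arc on it would make `τ`
  -- return after two steps, against `3 ≤ C.card`.
  by_cases hes : e ∈ s ∧ σ e = τ e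
  · right
    refine hG.isCycleOn_unique hσ hτ hes.1 he hes.2 (fun j hj hje => ?_) hadj
    refine (harc j hj fun h => absurd h hje).resolve_left ?_
    exact hσ.apply_ne ⟨j, hj, e, hes.1, hje⟩ hj
  · left
    have hcard : s.card ≤ 2 := hG.card_le_two_of_isCycleOn hσ fun j hj =>
      harc j hj fun h1 h2 => hes (by subst h1; exact ⟨hj, h2⟩)
    intro j hj
    by_contra h0
    obtain ⟨hjC, hjτ⟩ :=
      (symmPart_ne_zero_or_of_addCycle_ne_zero (hne j hj)).resolve_left (not_not.2 h0)
    have hback := hne (σ j) (hσ.1.mapsTo hj)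
    rw [hσ.apply_apply_eq hcard hj] at hback
    obtain ⟨hjC', hjτ'⟩ := (symmPart_ne_zero_or_of_addCycle_ne_zero hback).resolve_left
      fun h => symmPart_ne_zero_comm.1 h h0
    rw [hjτ] at hjτ'
    have hdvd : C.card ∣ 2 := (hτ.pow_apply_eq hjC).1 (by rw [pow_two, Perm.mul_apply, ← hjτ'])
    have := Nat.le_of_dvd two_pos hdvd
    omega

theorem NegativeCycles.addCycle (hP : P.NegativeCycles) (hG : G.IsAcyclic)
    (hPG : P.graph ≤ G) (hC : 3 ≤ C.card) (hτ : τ.IsCycleOn C) (he : e ∈ C)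
    (hadj : ∀ j ∈ C, j ≠ e → G.Adj j (τ j)) : (P.addCycle τ C e).NegativeCycles := by
  intro σ s hs hσ h
  have hne : ∀ j ∈ s, P.addCycle τ C e (σ j) j ≠ 0 := by
    rw [← Finset.prod_ne_zero_iff, h]
    decide
  rcases addCycle_cycle hG hPG hC hτ he hadj hσ hne with h1 | ⟨rfl, h1⟩
  · rw [Finset.prod_congr rfl fun j hj => (addCycle_of_symmPart_ne_zero (h1 j hj)).trans
      (symmPart_apply_of_ne_zero (h1 j hj))] at h
    exact hP σ s hs hσ h
  · rw [Finset.prod_congr rfl fun j hj => by rw [h1 j hj],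
      prod_addCycle he (symmPart_closing_arc_eq_zero hG hPG hC hτ hadj)] at h
    exact absurd h (by decide)

theorem not_shortCycles_addCycle (hG : G.IsAcyclic)
    (hPG : P.graph ≤ G) (hC : 3 ≤ C.card) (hτ : τ.IsCycleOn C) (he : e ∈ C)
    (hadj : ∀ j ∈ C, j ≠ e → G.Adj j (τ j)) : ¬ (P.addCycle τ C e).ShortCycles := by
  intro h
  have hprod := prod_addCycle he (symmPart_closing_arc_eq_zero hG hPG hC hτ hadj)
  have := h τ C ⟨e, he⟩ hτ (by rw [← Finset.prod_ne_zero_iff, hprod]; decide)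
  omega

/-- Supports of `P` use only loops and 2-cycles, which `addCycle` keeps. Conversely, if a support
uses the new cycle on `C`, its part on `C` is replaced by a support of `C` in `P`. -/
theorem ShortCycles.supports_addCycle_iff (hP : P.ShortCycles) (hG : G.IsAcyclic)
    (hPG : P.graph ≤ G) (hC : 3 ≤ C.card) (hτ : τ.IsCycleOn C) (he : e ∈ C)
    (hadj : ∀ j ∈ C, j ≠ e → G.Adj j (τ j)) (hPC : P.Supports C) (α : Finset (Fin n)) :
    P.Supports α ↔ (P.addCycle τ C e).Supports α := by
  constructor
  · rintro ⟨σ, hfix, hne⟩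
    refine ⟨σ, hfix, fun j hj => ?_⟩
    obtain ⟨s, hjs, hsα, hσ⟩ := Perm.exists_isCycleOn_mem_subset hfix hj
    have hcard := hP σ s ⟨j, hjs⟩ hσ fun i hi => hne i (hsα hi)
    have hback := hne (σ j) (hsα (hσ.1.mapsTo hjs))
    rw [hσ.apply_apply_eq hcard hjs] at hback
    have hsym := symmPart_ne_zero.2 ⟨hne j hj, hback⟩
    rwa [addCycle_of_symmPart_ne_zero hsym]
  · rintro ⟨σ, hfix, hne⟩
    have hcyc : ∀ j ∈ α, ∃ s ⊆ α, j ∈ s ∧ σ.IsCycleOn s ∧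
        ((∀ j ∈ s, P.symmPart (σ j) j ≠ 0) ∨ (s = C ∧ ∀ j ∈ s, σ j = τ j)) := by
      intro j hj
      obtain ⟨s, hjs, hsα, hσ⟩ := Perm.exists_isCycleOn_mem_subset hfix hj
      exact ⟨s, hsα, hjs, hσ, addCycle_cycle hG hPG hC hτ he hadj hσ fun i hi => hne i (hsα hi)⟩
    by_cases hex : C ⊆ α ∧ σ.IsCycleOn C
    · obtain ⟨hCα, hσC⟩ := hex
      obtain ⟨ρ, hρfix, hρne⟩ := hPC
      have hmem : ∀ i, σ i ∉ C ↔ i ∉ C := fun i => not_congr hσC.apply_mem_iff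
      have hρ : ∀ i ∈ C, ρ i ∈ C := by
        intro i hi
        by_contra h
        exact h (by rwa [ρ.injective (hρfix _ h)])
      -- `κ` agrees with `σ` off `C` and is the identity on `C`, so `κ * ρ` is `σ` off `C` and `ρ`
      -- on `C`.
      let κ : Perm (Fin n) := Perm.ofSubtype (p := fun i => i ∉ C) (σ.subtypePerm hmem)
      have hout : ∀ i, i ∉ C →
          (κ * ρ) i = σ i := by
        intro i hi
        rw [Perm.mul_apply, hρfix i hi, Perm.ofSubtype_apply_of_mem (p := fun i => i ∉ C) _ hi]
        rfl
      have hin : ∀ i ∈ C,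
          (κ * ρ) i = ρ i := by
        intro i hi
        rw [Perm.mul_apply,
          Perm.ofSubtype_apply_of_not_mem (p := fun i => i ∉ C) _ (not_not.2 (hρ i hi))]
      refine ⟨κ * ρ,
        fun i hi => ?_, fun i hi => ?_⟩
      · rw [hout i fun h => hi (hCα h), hfix i hi]
      · by_cases hiC : i ∈ C
        · rw [hin i hiC]
          exact hρne i hiC
        · rw [hout i hiC]
          obtain ⟨s, -, his, -, h | ⟨rfl, -⟩⟩ := hcyc i hi
          · exact (symmPart_ne_zero.1 (h i his)).1
          · exact absurd his hiC
    · refine ⟨σ, hfix, fun i hi => ?_⟩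
      obtain ⟨s, hsα, his, hσ, h | ⟨rfl, -⟩⟩ := hcyc i hi
      · exact (symmPart_ne_zero.1 (h i his)).1
      · exact absurd ⟨hsα, hσ⟩ hex

end AddCycle

/-- `P` can be replaced by a sign pattern which supports the same sets, has negative cycles, and has
a cycle of length at least three. -/
def HasLongCycleMate (P : SignPattern n) : Prop :=
  ∃ R : SignPattern n, R.NegativeCycles ∧ ¬ R.ShortCycles ∧ ∀ α, P.Supports α ↔ R.Supports α

/-- The new cycle runs along `l`; its closing arc goes from the last entry to the first. Allowing
`G` larger than `P.graph` lets the chain pass between components. -/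
theorem hasLongCycleMate_of_isChain {P : SignPattern n} (hP : P.NegativeCycles)
    (hP' : P.ShortCycles) {G : SimpleGraph (Fin n)} (hG : G.IsAcyclic) (hPG : P.graph ≤ G)
    {l : List (Fin n)} (hl : 3 ≤ l.length) (hnd : l.Nodup) (hchain : l.IsChain G.Adj)
    (hsupp : P.Supports l.toFinset) : P.HasLongCycleMate := by
  have hcyc := hnd.isCycleOn_formPerm
  have hset : {a | a ∈ l} = (l.toFinset : Set (Fin n)) := by ext; simp
  rw [hset] at hcyc
  have hC : 3 ≤ l.toFinset.card := by rwa [List.toFinset_card_of_nodup hnd]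
  have he : l[l.length - 1] ∈ l.toFinset := by simp
  have hadj : ∀ j ∈ l.toFinset, j ≠ l[l.length - 1] → G.Adj j (l.formPerm j) := by
    intro j hj hne
    rw [List.mem_toFinset, List.mem_iff_getElem] at hj
    obtain ⟨i, hi, rfl⟩ := hj
    have hi' : i + 1 < l.length := by
      by_contra h
      obtain rfl : i = l.length - 1 := by omega
      exact hne rfl
    rw [List.formPerm_apply_lt_getElem _ hnd _ hi']
    exact List.isChain_iff_getElem.1 hchain i hi'
  exact ⟨_, hP.addCycle hG hPG hC hcyc he hadj, not_shortCycles_addCycle hG hPG hC hcyc he hadj,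
    hP'.supports_addCycle_iff hG hPG hC hcyc he hadj hsupp⟩

end SignPattern

/-! ### Finding a supported path on three or four vertices -/

namespace SignPattern

variable {n : ℕ} {P : SignPattern n}

/-- The loop at `v` and the 2-cycle on `x`, `y` support the path, so the edge `v x` need only lie in
`G`. -/
theorem hasLongCycleMate_of_loop_adj_adj (hP : P.NegativeCycles) (hP' : P.ShortCycles)
    {G : SimpleGraph (Fin n)} (hG : G.IsAcyclic) (hPG : P.graph ≤ G) {v x y : Fin n}
    (hv : P v v ≠ 0) (hvx : G.Adj v x) (hxy : P.graph.Adj x y) (hvy : v ≠ y) :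
    P.HasLongCycleMate := by
  have hne1 := hvx.ne
  have hne2 := hxy.ne
  refine hasLongCycleMate_of_isChain hP hP' hG hPG (l := [v, x, y]) (by simp)
    (by simp [hne1, hne2, hvy]) (by simp [hvx, hPG hxy]) ⟨swap x y, ?_, ?_⟩
  · intro i hi
    simp only [List.mem_toFinset, List.mem_cons, List.not_mem_nil, or_false, not_or] at hi
    exact swap_apply_of_ne_of_ne hi.2.1 hi.2.2
  · intro i hi
    simp only [List.mem_toFinset, List.mem_cons, List.not_mem_nil, or_false] at hi
    rcases hi with rfl | rfl | rfl
    · rwa [swap_apply_of_ne_of_ne hne1 hvy]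
    · rw [swap_apply_left]
      exact hxy.2.2
    · rw [swap_apply_right]
      exact hxy.2.1

theorem hasLongCycleMate_of_adj_adj_adj (hP : P.NegativeCycles) (hP' : P.ShortCycles)
    {G : SimpleGraph (Fin n)} (hG : G.IsAcyclic) (hPG : P.graph ≤ G) {w x y z : Fin n}
    (hwx : P.graph.Adj w x) (hxy : G.Adj x y) (hyz : P.graph.Adj y z) (hwy : w ≠ y) (hwz : w ≠ z)
    (hxz : x ≠ z) : P.HasLongCycleMate := by
  have hne1 := hwx.ne
  have hne2 := hxy.ne
  have hne3 := hyz.ne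
  refine hasLongCycleMate_of_isChain hP hP' hG hPG (l := [w, x, y, z]) (by simp)
    (by simp [hne1, hne2, hne3, hwy, hwz, hxz]) (by simp [hPG hwx, hxy, hPG hyz])
    ⟨swap w x * swap y z, ?_, ?_⟩
  · intro i hi
    simp only [List.mem_toFinset, List.mem_cons, List.not_mem_nil, or_false, not_or] at hi
    rw [Perm.mul_apply, swap_apply_of_ne_of_ne hi.2.2.1 hi.2.2.2,
      swap_apply_of_ne_of_ne hi.1 hi.2.1]
  · intro i hi
    simp only [List.mem_toFinset, List.mem_cons, List.not_mem_nil, or_false] at hi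
    rw [Perm.mul_apply]
    rcases hi with rfl | rfl | rfl | rfl
    · rw [swap_apply_of_ne_of_ne hwy hwz, swap_apply_left]
      exact hwx.2.2
    · rw [swap_apply_of_ne_of_ne hne2 hxz, swap_apply_right]
      exact hwx.2.1
    · rw [swap_apply_left, swap_apply_of_ne_of_ne hwz.symm hxz.symm]
      exact hyz.2.2
    · rw [swap_apply_right, swap_apply_of_ne_of_ne hwy.symm hne2.symm]
      exact hyz.2.1

/-- If `v` reaches `a`, use `v, a, b` or the first three vertices of the path to `a`; otherwise join
`v` to `a` in the forest. -/
theorem hasLongCycleMate_of_loop_adj (hP : P.NegativeCycles) (hP' : P.ShortCycles)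
    {v a b : Fin n} (hv : P v v ≠ 0) (hab : P.graph.Adj a b) (hva : v ≠ a) (hvb : v ≠ b) :
    P.HasLongCycleMate := by
  have hG := hP'.isAcyclic_graph
  by_cases hr : P.graph.Reachable v a
  · obtain ⟨p, hp⟩ := hr.exists_isPath
    rcases p with _ | @⟨_, x, _, hvx, p⟩
    · exact absurd rfl hva
    rcases p with _ | @⟨_, y, _, hxy, p⟩
    · exact hasLongCycleMate_of_loop_adj_adj hP hP' hG le_rfl hv hvx hab hvb
    · refine hasLongCycleMate_of_loop_adj_adj hP hP' hG le_rfl hv hvx hxy ?_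
      rintro rfl
      simp at hp
  · refine hasLongCycleMate_of_loop_adj_adj hP hP' (hG.sup_edge_of_not_reachable hr) le_sup_left
      hv (x := a) ?_ hab hvb
    simp [SimpleGraph.edge_adj, hva]

/-- The supported set may change: a path from `a` to `c` with at least three edges supplies its own
first four vertices, while a shorter one is extended by `b` or `d`. If there is none, the edge `a c`
is added. -/
theorem hasLongCycleMate_of_adj_adj (hP : P.NegativeCycles) (hP' : P.ShortCycles)
    {a b c d : Fin n} (hab : P.graph.Adj a b) (hcd : P.graph.Adj c d) (hac : a ≠ c) (had : a ≠ d)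
    (hbc : b ≠ c) (hbd : b ≠ d) : P.HasLongCycleMate := by
  have hG := hP'.isAcyclic_graph
  by_cases hr : P.graph.Reachable a c
  · obtain ⟨p, hp⟩ := hr.exists_isPath
    rcases p with _ | @⟨_, x, _, hax, p⟩
    · exact absurd rfl hac
    rcases p with _ | @⟨_, y, _, hxy, p⟩
    · exact hasLongCycleMate_of_adj_adj_adj hP hP' hG le_rfl hab.symm hax hcd hbc hbd had
    rcases p with _ | @⟨_, z, _, hyz, p⟩
    · by_cases hxb : x = b
      · subst hxb
        exact hasLongCycleMate_of_adj_adj_adj hP hP' hG le_rfl hab hxy hcd hac had hbd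
      · exact hasLongCycleMate_of_adj_adj_adj hP hP' hG le_rfl hab.symm hax hxy (Ne.symm hxb) hbc
          hac
    · have hnd := hp.support_nodup
      have hz : z ∈ p.support := p.start_mem_support
      simp only [SimpleGraph.Walk.support_cons, List.nodup_cons, List.mem_cons, not_or] at hnd
      refine hasLongCycleMate_of_adj_adj_adj hP hP' hG le_rfl hax hxy hyz hnd.1.2.1 ?_ ?_
      · rintro rfl
        exact hnd.1.2.2 hz
      · rintro rfl
        exact hnd.2.1.2 hz
  · refine hasLongCycleMate_of_adj_adj_adj hP hP' (hG.sup_edge_of_not_reachable hr) le_sup_left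
      hab.symm (x := a) (y := c) ?_ hcd hbc hbd had
    simp [SimpleGraph.edge_adj, hac]

/-- Any edge misses one of three loops, which reduces to the previous case of a loop and an edge.
Without edges, the three vertices are joined into a path, supported by the loops. -/
theorem hasLongCycleMate_of_loops (hP : P.NegativeCycles) (hP' : P.ShortCycles)
    {u v w : Fin n} (hu : P u u ≠ 0) (hv : P v v ≠ 0) (hw : P w w ≠ 0) (huv : u ≠ v)
    (huw : u ≠ w) (hvw : v ≠ w) : P.HasLongCycleMate := by
  by_cases hbot : ∃ a b, P.graph.Adj a b
  · obtain ⟨a, b, hab⟩ := hbot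
    by_cases h1 : u ≠ a ∧ u ≠ b
    · exact hasLongCycleMate_of_loop_adj hP hP' hu hab h1.1 h1.2
    by_cases h2 : v ≠ a ∧ v ≠ b
    · exact hasLongCycleMate_of_loop_adj hP hP' hv hab h2.1 h2.2
    · refine hasLongCycleMate_of_loop_adj hP hP' hw hab ?_ ?_ <;> grind
  · push Not at hbot
    have hG := hP'.isAcyclic_graph
    have hr1 : ¬ P.graph.Reachable u v := by
      rintro ⟨_ | ⟨h, -⟩⟩
      · exact huv rfl
      · exact hbot _ _ h
    have hG1 := hG.sup_edge_of_not_reachable hr1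
    have hr2 : ¬ (P.graph ⊔ SimpleGraph.edge u v).Reachable w v := by
      rintro ⟨_ | ⟨h, -⟩⟩
      · exact hvw rfl
      · rw [SimpleGraph.sup_adj, SimpleGraph.edge_adj] at h
        rcases h with h | h
        · exact hbot _ _ h
        · grind
    have hG2 := hG1.sup_edge_of_not_reachable hr2
    refine hasLongCycleMate_of_isChain hP hP' hG2 (le_sup_left.trans le_sup_left)
      (l := [u, v, w]) (by simp) (by simp [huv, huw, hvw])
      (by simp [SimpleGraph.edge_adj, huv, hvw]) ⟨1, fun _ _ => rfl, ?_⟩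
    intro i hi
    simp only [List.mem_toFinset, List.mem_cons, List.not_mem_nil, or_false] at hi
    rcases hi with rfl | rfl | rfl <;> assumption

/-- The supporting permutation is an involution on `α`, so `3 ≤ α.card` leaves a loop with a
disjoint 2-cycle, three loops, or two disjoint 2-cycles. -/
theorem hasLongCycleMate_of_supports (hP : P.NegativeCycles) (hP' : P.ShortCycles)
    {α : Finset (Fin n)} (hα : 3 ≤ α.card) (h : P.Supports α) : P.HasLongCycleMate := by
  obtain ⟨σ, hfix, hne⟩ := h
  have hmem : ∀ j ∈ α, σ j ∈ α := by
    intro j hj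
    by_contra h
    exact h (by rwa [σ.injective (hfix _ h)])
  have hinv : ∀ j ∈ α, σ (σ j) = j := by
    intro j hj
    obtain ⟨s, hjs, hsα, hσ⟩ := Perm.exists_isCycleOn_mem_subset hfix hj
    exact hσ.apply_apply_eq (hP' σ s ⟨j, hjs⟩ hσ fun i hi => hne i (hsα hi)) hjs
  have hadj : ∀ j ∈ α, σ j ≠ j → P.graph.Adj j (σ j) := by
    intro j hj hjne
    have := hne (σ j) (hmem j hj)
    rw [hinv j hj] at this
    exact ⟨hjne.symm, this, hne j hj⟩
  have hloop : ∀ j ∈ α, σ j = j → P j j ≠ 0 := by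
    intro j hj hjj
    have := hne j hj
    rwa [hjj] at this
  by_cases hl : ∃ i ∈ α, σ i = i
  · obtain ⟨i, hi, hii⟩ := hl
    by_cases he : ∃ j ∈ α, σ j ≠ j
    · obtain ⟨j, hj, hjj⟩ := he
      refine hasLongCycleMate_of_loop_adj hP hP' (hloop i hi hii) (hadj j hj hjj) ?_ ?_
      · rintro rfl
        exact hjj hii
      · intro h
        have := hinv j hj
        rw [← h, hii] at this
        exact hjj (h ▸ this)
    · push Not at he
      obtain ⟨u, v, w, hu, hv, hw, huv, huw, hvw⟩ := Finset.two_lt_card_iff.1 hα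
      exact hasLongCycleMate_of_loops hP hP' (hloop u hu (he u hu)) (hloop v hv (he v hv))
        (hloop w hw (he w hw)) huv huw hvw
  · push Not at hl
    obtain ⟨i, hi⟩ : α.Nonempty := Finset.card_pos.1 (by omega)
    obtain ⟨j, hj, hjne⟩ : ∃ j ∈ α, j ∉ ({i, σ i} : Finset (Fin n)) := by
      refine Finset.exists_mem_notMem_of_card_lt_card ?_
      exact (Finset.card_le_two).trans_lt hα
    simp only [Finset.mem_insert, Finset.mem_singleton, not_or] at hjne
    refine hasLongCycleMate_of_adj_adj hP hP' (hadj i hi (hl i hi)) (hadj j hj (hl j hj))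
      (Ne.symm hjne.1) ?_ (Ne.symm hjne.2) fun h => hjne.1 (σ.injective h).symm
    intro h
    exact hjne.2 (by rw [h, hinv j hj])

end SignPattern

theorem mainTheorem4 {n : ℕ} (P : SignPattern n) (hP : P.IsSignSemiStable) :
    ∃ hu : P.HasUniqueSepr,
      ((∀ (m : ℕ) (R : SignPattern m) (hR : R.HasUniqueSepr),
          R.sepr hR = P.sepr hu → R.IsSignSemiStable) ↔
        ((∀ k : ℕ, 3 ≤ k → k ≤ n → (P.sepr hu)[k - 1]? = some SeprSymbol.N) ∨ n ≤ 2)) := by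
  have hneg := hP.negativeCycles
  refine ⟨hneg.hasUniqueSepr, fun h => ?_, fun hN m R hR hRP =>
    hneg.isSignSemiStable_of_sepr_eq hneg.hasUniqueSepr hN hR hRP⟩
  by_contra hcon
  obtain ⟨α, hα, hsupp⟩ :=
    hneg.exists_supports_of_sepr_ne hneg.hasUniqueSepr fun h' => hcon (Or.inl h')
  obtain ⟨R, hRneg, hRlong, hPR⟩ := SignPattern.hasLongCycleMate_of_supports hneg hP.shortCycles
    hα hsupp
  exact hRlong (h n R hRneg.hasUniqueSepr (hneg.sepr_congr hRneg hPR _ _)).shortCycles
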